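/- Let $K$ be a field of characteristic $2$ and let $n\ge 1$. Let $\Pi=\begin{pmatrix}0&0&1_n\\0&1&0\\1_n&0&0\end{pmatrix}$ (blocks of sizes $n,1,n$), let $\mathfrak o_\Pi(2n+1)$ be the Lie algebra of all $M\in\mathfrak{gl}(2n+1,K)$ with $M^T\Pi+\Pi M=0$, and let $\mathfrak g=\mathfrak o_\Pi^{(1)}(2n+1)$ be its first derived algebra. Set $$x_i=E_{i,i+1}+E_{n+i+2,n+i+1},\quad h_i=E_{i,i}+E_{i+1,i+1}+E_{n+i+1,n+i+1}+E_{n+i+2,n+i+2}\qquad(1\le i\le n-1),$$ $$x_n=E_{n,n+1}+E_{n+1,2n+1},\qquad h_n=E_{n,n}+E_{2n+1,2n+1},\qquad y_i=x_i^T\quad(1\le i\le n).$$ Let $A$ be the $n\times n$ matrix over $K$ with $A_{nn}=1$, $A_{ij}=1$ if $|i-j|=1$, and all other entries $0$. Then: 1. The $x_i$, $y_i$ generate the Lie algebra $\mathfrak g$, and they are Chevalley generators for the Cartan matrix $A$: $[x_i,y_j]=\delta_{ij}h_i$, $[h_i,h_j]=0$, $[h_i,x_j]=A_{ij}x_j$,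 $[h_i,y_j]=-A_{ij}y_j$ for all $i,j$. 2. Let $\mathfrak n$ be the Lie subalgebra of $\mathfrak g$ generated by $x_1,\dots,x_n$. Then $\mathfrak n$ is presented by the generators $x_1,\dots,x_n$, the Serre relations $(\mathrm{ad}_{x_k})^{1+B_{kj}}(x_j)=0$ for all $k\ne j$, where $B_{kj}=0$ if $|k-j|>1$, $B_{kj}=1$ if $|k-j|=1$ and $k<n$, and $B_{n,n-1}=2$, together with the relations $$[[x_{i-1},x_i],[x_i,x_{i+1}]]=0\qquad\text{for } 2\le i\le n-1.$$ That is, the homomorphism from the free Lie algebra over $K$ on $X_1,\dots,X_n$ to $\mathfrak n$ with $X_i\mapsto x_i$ induces an isomorphism from its quotient by the ideal generated by these relators onto $\mathfrak n$. -/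

import Mathlib

attribute [local instance 100] LieRing.ofAssociativeRing

noncomputable section

namespace OrthPi

open Matrix

/-- The index set of the rows and columns of `(2n+1) × (2n+1)` matrices, in three blocks of
sizes `n`, `1`, `n`: `inl i` is the `i`-th index, `inr (inl ())` is the middle (the `(n+1)`-st)
one, and `inr (inr i)` is the one at position `n + 1 + i`. -/
abbrev Idx (n : ℕ) : Type := Fin n ⊕ (Unit ⊕ Fin n)

/-- The position `i` in the first block. -/
abbrev fst {n : ℕ} (i : Fin n) : Idx n := Sum.inl i

/-- The middle position `n + 1`. -/
abbrev mid {n : ℕ} : Idx n := Sum.inr (Sum.inl ())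

/-- The position `n + 1 + i`, in the last block. -/
abbrev lst {n : ℕ} (i : Fin n) : Idx n := Sum.inr (Sum.inr i)

variable (K : Type*) [Field K] (n : ℕ)

/-- The Gram matrix `Π = [[0, 0, 1ₙ], [0, 1, 0], [1ₙ, 0, 0]]` of the bilinear form. -/
def gram : Matrix (Idx n) (Idx n) K :=
  single mid mid 1 + ∑ i : Fin n, (single (fst i) (lst i) 1 + single (lst i) (fst i) 1)

/-- The Lie algebra of all matrices `M` that preserve the form, `Mᵀ Π + Π M = 0`. -/
def orth : LieSubalgebra K (Matrix (Idx n) (Idx n) K) :=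
  skewAdjointMatricesLieSubalgebra (gram K n)

/-- The first derived algebra `[orth, orth]`, as a Lie algebra of matrices. -/
def orthDerived : LieSubalgebra K (Matrix (Idx n) (Idx n) K) :=
  (LieIdeal.toLieSubalgebra K (orth K n) (LieAlgebra.derivedSeries K (orth K n) 1)).map
    (orth K n).incl

/-- The elements `x_i`. In 1-based positions: `x_i = E_{i,i+1} + E_{n+i+2,n+i+1}` for `i < n`
and `x_n = E_{n,n+1} + E_{n+1,2n+1}`. -/
def x (i : Fin n) : Matrix (Idx n) (Idx n) K :=
  if h : i.val + 1 < n then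
    single (fst i) (fst ⟨i.val + 1, h⟩) 1 + single (lst ⟨i.val + 1, h⟩) (lst i) 1
  else
    single (fst i) mid 1 + single mid (lst i) 1

/-- `y_i` is the transpose of `x_i`. -/
def y (i : Fin n) : Matrix (Idx n) (Idx n) K := (x K n i)ᵀ

/-- The elements `h_i`. In 1-based positions:
`h_i = E_{i,i} + E_{i+1,i+1} + E_{n+i+1,n+i+1} + E_{n+i+2,n+i+2}` for `i < n`
and `h_n = E_{n,n} + E_{2n+1,2n+1}`. -/
def h (i : Fin n) : Matrix (Idx n) (Idx n) K :=
  if h : i.val + 1 < n then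
    single (fst i) (fst i) 1 + single (fst ⟨i.val + 1, h⟩) (fst ⟨i.val + 1, h⟩) 1 +
      single (lst i) (lst i) 1 + single (lst ⟨i.val + 1, h⟩) (lst ⟨i.val + 1, h⟩) 1
  else
    single (fst i) (fst i) 1 + single (lst i) (lst i) 1

/-- The Lie algebra `𝔫`: the Lie subalgebra generated by the `x_i`. -/
def nPlus : LieSubalgebra K (Matrix (Idx n) (Idx n) K) :=
  LieSubalgebra.lieSpan K _ (Set.range (x K n))

/-- The Cartan matrix, over a field of characteristic two: the last diagonal entry is `1`, the
other diagonal entries are `0`, neighbours have the entry `1`, and all else is `0`. -/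
def cartan : Matrix (Fin n) (Fin n) K := fun i j =>
  if i.val + 1 = j.val ∨ j.val + 1 = i.val ∨ (i = j ∧ i.val + 1 = n) then 1 else 0

variable {K n}

open Classical in
/-- The numbers `B_{kj}` in the Serre relations `(ad x_k)^{1 + B_{kj}} x_j = 0`, for a Cartan
matrix over a field of characteristic `p = 2` (all generators even).
If `A_{kk} = 0`, then `B_{kj}` is `p - 1 = 1` or `0`, according to whether `A_{kj} ≠ 0` or not.
If `A_{kk} ≠ 0`, then `B_{kj}` is the least non-negative integer that represents
`-2 A_{kj} / A_{kk} = 0`, that is `0`, except that it is read as `2` when `A_{jk} = A_{kk}`. -/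
def serreExponent (A : Matrix (Fin n) (Fin n) K) (k j : Fin n) : ℕ :=
  if A k k = 0 then (if A k j = 0 then 0 else 1)
  else (if A j k = A k k then 2 else 0)

variable (K n)

/-- The Serre relators `(ad x_k)^{1 + B_{kj}} x_j`, `k ≠ j`, in the free Lie algebra. -/
def serreRelators : Set (FreeLieAlgebra K (Fin n)) :=
  {r | ∃ k j : Fin n, k ≠ j ∧
    r = ((LieAlgebra.ad K (FreeLieAlgebra K (Fin n)) (FreeLieAlgebra.of K k)) ^
      (1 + serreExponent (cartan K n) k j)) (FreeLieAlgebra.of K j)}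

/-- The non-Serre relators `[[x_{i-1}, x_i], [x_i, x_{i+1}]]`, for all `i` such that `i - 1`, `i`
and `i + 1` are indices of generators. -/
def nonSerreRelators : Set (FreeLieAlgebra K (Fin n)) :=
  {r | ∃ a b c : Fin n, a.val + 1 = b.val ∧ b.val + 1 = c.val ∧
    r = ⁅⁅FreeLieAlgebra.of K a, FreeLieAlgebra.of K b⁆,
      ⁅FreeLieAlgebra.of K b, FreeLieAlgebra.of K c⁆⁆}

/-- The ideal of the free Lie algebra generated by all the relators. -/
def relIdeal : LieIdeal K (FreeLieAlgebra K (Fin n)) :=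
  LieSubmodule.lieSpan K (FreeLieAlgebra K (Fin n)) (serreRelators K n ∪ nonSerreRelators K n)

/-- The Lie algebra presented by generators `x_1, …, x_n` and the relations. -/
abbrev Presented : Type _ := FreeLieAlgebra K (Fin n) ⧸ relIdeal K n

/-- The `i`-th generator of the presented Lie algebra. -/
def gen (i : Fin n) : Presented K n := LieSubmodule.Quotient.mk (FreeLieAlgebra.of K i)

end OrthPi

end

/-! Write `a ↦ a'` for the involution `bar` of the positions, which exchanges the outer blocks. In
characteristic 2 the derived algebra is spanned by the matrices `E_{a,b} + E_{b',a'}` (`rootMat`),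
whose brackets are given by `lie_rootMat`. Membership in `orth` says that `ΠM` is symmetric, and a
commutator of two such matrices also has `ΠM` of zero diagonal (`lie_apply_bar_self`). Conversely,
brackets of the `x_i` and `y_i` climb to every root matrix through the middle position, so they
generate.

For the presentation, number the generators from 0 to `N = n - 1` and let `c_i = [X_i, [X_{i+1}, …,
X_N]]` be the maximal chains. The relations force the span of all chains and all `[c_i, c_j]` to be
stable under each `ad X_k` (`Relations.lie_mem_chainSpan`), so it is the whole presented algebra.
These elements mirror the positive roots of type `B_n`: chains ending before `N` are the `e_i -
e_j`, maximal chains the `e_i`, and brackets of two distinct maximal chains the `e_i + e_j`. The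
delicate points are that an inner generator kills a chain, which needs the non-Serre relations
(`lie_chain_second`), and that `X_N` kills `[c_i, c_j]` (`lie_last_lie_full`).

The homomorphism to matrices sends this spanning set to root matrices, from whose entries the linear
map `combine` recovers it. Hence the homomorphism is injective, with no dimension count. -/

noncomputable section

namespace OrthPi

/-! ### Spanning set forced by the relations -/

section Strings

variable {L : Type*} [LieRing L]

/-- The iterated bracket `[X_i, [X_{i+1}, …, X_{i+d}]]`. -/
def chain (X : ℕ → L) : ℕ → ℕ → L
  | i, 0 => X i
  | i, d + 1 => ⁅X i, chain X (i + 1) d⁆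

@[simp] lemma chain_zero (X : ℕ → L) (i : ℕ) : chain X i 0 = X i := rfl

lemma chain_succ (X : ℕ → L) (i d : ℕ) : chain X i (d + 1) = ⁅X i, chain X (i + 1) d⁆ := rfl

/-- The defining relations, for a sequence of elements that vanishes beyond the index `N`, in a Lie
ring of characteristic two. -/
structure Relations (X : ℕ → L) (N : ℕ) : Prop where
  two (a : L) : a + a = 0
  vanish (k : ℕ) : N < k → X k = 0
  comm (k j : ℕ) : k + 1 < j → ⁅X k, X j⁆ = 0
  serre_up (k : ℕ) : k ≠ N → ⁅X k, ⁅X k, X (k + 1)⁆⁆ = 0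
  serre_down (k : ℕ) : k + 1 ≠ N → ⁅X (k + 1), ⁅X (k + 1), X k⁆⁆ = 0
  cubic (k : ℕ) : k + 1 = N → ⁅X (k + 1), ⁅X (k + 1), ⁅X (k + 1), X k⁆⁆⁆ = 0
  nonSerre (k : ℕ) : ⁅⁅X k, X (k + 1)⁆, ⁅X (k + 1), X (k + 2)⁆⁆ = 0

namespace Relations

variable {X : ℕ → L} {N : ℕ} (R : Relations X N)
include R

lemma neg_eq (a : L) : -a = a := neg_eq_of_add_eq_zero_left (R.two a)

lemma lie_symm (a b : L) : ⁅a, b⁆ = ⁅b, a⁆ := by rw [← lie_skew, R.neg_eq]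

lemma comm' (k j : ℕ) (h : j + 1 < k) : ⁅X k, X j⁆ = 0 := by
  rw [R.lie_symm, R.comm _ _ h]

lemma chain_eq_zero (i d : ℕ) (h : N < i + d) : chain X i d = 0 := by
  induction d generalizing i with
  | zero => exact R.vanish _ (by omega)
  | succ d ih => rw [chain_succ, ih _ (by omega), lie_zero]

lemma lie_chain_of_lt (k i d : ℕ) (h : k + 1 < i) : ⁅X k, chain X i d⁆ = 0 := by
  induction d generalizing i with
  | zero => exact R.comm _ _ h
  | succ d ih =>
    rw [chain_succ, leibniz_lie, R.comm _ _ h, ih _ (by omega), zero_lie, lie_zero, add_zero]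

lemma lie_chain_of_gt (k i d : ℕ) (h : i + d + 1 < k) : ⁅X k, chain X i d⁆ = 0 := by
  induction d generalizing i with
  | zero => exact R.comm' _ _ h
  | succ d ih =>
    rw [chain_succ, leibniz_lie, R.comm' _ _ (by omega), ih _ (by omega), zero_lie, lie_zero,
      add_zero]

lemma lie_chain_extend (i d : ℕ) : ⁅X (i + d + 1), chain X i d⁆ = chain X i (d + 1) := by
  induction d generalizing i with
  | zero => exact R.lie_symm _ _
  | succ d ih =>
    rw [chain_succ, leibniz_lie, R.comm' _ _ (by omega), zero_lie, zero_add,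
      show i + (d + 1) + 1 = (i + 1) + d + 1 by omega, ih, ← chain_succ]

lemma lie_chain_first (i d : ℕ) (h : i ≠ N) : ⁅X i, chain X i d⁆ = 0 := by
  match d with
  | 0 => exact lie_self _
  | 1 => exact R.serre_up i h
  | d + 2 =>
    have hc : ⁅X i, chain X (i + 2) d⁆ = 0 := R.lie_chain_of_lt _ _ _ (by omega)
    have h2 := R.serre_up i h
    rw [chain_succ, chain_succ, leibniz_lie (X i) (X (i + 1)), hc, lie_zero, add_zero,
      leibniz_lie, h2, hc, zero_lie, lie_zero, add_zero]

lemma lie_chain_last (i d : ℕ) (h : i + d ≠ N) : ⁅X (i + d), chain X i d⁆ = 0 := by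
  induction d generalizing i with
  | zero => exact lie_self _
  | succ d ih =>
    rcases d with _ | d
    · rw [chain_succ, chain_zero, R.lie_symm (X i)]
      exact R.serre_down i h
    · rw [chain_succ, leibniz_lie, R.comm' _ _ (by omega), zero_lie, zero_add,
        show i + (d + 1 + 1) = i + 1 + (d + 1) by omega, ih _ (by omega), lie_zero]

/-- The only use of the non-Serre relation. By Jacobi the bracket becomes that of `[X_i, X_{i+1}]`
with the chain starting at `i + 1`; the relation kills this for a chain of length two, and the tail
of a longer chain commutes with `X_i` and `X_{i+1}`. -/
lemma lie_chain_second (i d : ℕ) (h : i + 1 ≠ N) :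
    ⁅X (i + 1), chain X i (d + 2)⁆ = 0 := by
  have key : ⁅⁅X i, X (i + 1)⁆, chain X (i + 1) (d + 1)⁆ = 0 := by
    rcases d with _ | d
    · exact R.nonSerre i
    · have h1 : ⁅X i, chain X (i + 3) d⁆ = 0 := R.lie_chain_of_lt _ _ _ (by omega)
      have h2 : ⁅X (i + 1), chain X (i + 3) d⁆ = 0 := R.lie_chain_of_lt _ _ _ (by omega)
      have h3 : ⁅⁅X i, X (i + 1)⁆, chain X (i + 3) d⁆ = 0 := by
        rw [lie_lie, h1, h2, lie_zero, lie_zero, sub_zero]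
      rw [chain_succ, chain_succ, leibniz_lie (X (i + 1)) (X (i + 2)), h2, lie_zero, add_zero,
        leibniz_lie, R.nonSerre, h3, zero_lie, lie_zero, add_zero]
  rw [chain_succ, leibniz_lie, R.lie_chain_first _ _ h, lie_zero, add_zero, R.lie_symm (X (i + 1)),
    key]

lemma lie_chain_inner (k i d : ℕ) (h : k ≠ N) (hi : i < k) (hk : k < i + d) :
    ⁅X k, chain X i d⁆ = 0 := by
  induction d generalizing i with
  | zero => omega
  | succ d ih =>
    -- While `k` is beyond the second place, `X k` commutes with the first letter, which can be
    -- peeled off.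
    rcases Nat.lt_or_ge (i + 1) k with h' | h'
    · rw [chain_succ, leibniz_lie, R.comm' _ _ h', zero_lie, zero_add, ih _ h' (by omega), lie_zero]
    · obtain rfl : k = i + 1 := by omega
      obtain ⟨d, rfl⟩ : ∃ e, d = e + 1 := ⟨d - 1, by omega⟩
      exact R.lie_chain_second i d h

/-- The excluded case is `X N` against a maximal chain; there the bracket is a new element, of the
second type in `chainSpan`. -/
lemma lie_chain_mem (k i d : ℕ) (h : k ≠ N ∨ i + d ≠ N) :
    ⁅X k, chain X i d⁆ = if k + 1 = i then chain X k (d + 1)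
      else if k = i + d + 1 then chain X i (d + 1) else 0 := by
  split_ifs with h1 h2
  · subst h1; rfl
  · subst h2; exact R.lie_chain_extend i d
  · rcases Nat.lt_or_ge N (i + d) with hN | hN
    · rw [R.chain_eq_zero _ _ hN, lie_zero]
    rcases Nat.lt_or_ge N k with hk | hk
    · rw [R.vanish _ hk, zero_lie]
    rcases Nat.lt_or_ge k i with h3 | h3
    · exact R.lie_chain_of_lt _ _ _ (by omega)
    rcases Nat.lt_or_ge (i + d + 1) k with h4 | h4
    · exact R.lie_chain_of_gt _ _ _ h4
    rcases eq_or_ne k (i + d) with rfl | h6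
    · exact R.lie_chain_last _ _ (by omega)
    rcases eq_or_ne k i with rfl | h5
    · exact R.lie_chain_first _ _ (by omega)
    exact R.lie_chain_inner _ _ _ (by omega) (by omega) (by omega)

lemma lie_full (k i : ℕ) (hk : k < N) (hi : i ≤ N) :
    ⁅X k, chain X i (N - i)⁆ = if k + 1 = i then chain X k (N - k) else 0 := by
  rw [R.lie_chain_mem _ _ _ (Or.inl hk.ne), if_neg (by omega : ¬ k = i + (N - i) + 1)]
  split_ifs with h
  · rw [show N - i + 1 = N - k by omega]
  · rfl

lemma lie_lie_last_full (i : ℕ) (hi : i ≤ N) : ⁅X N, ⁅X N, chain X i (N - i)⁆⁆ = 0 := by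
  induction hi using Nat.decreasingInduction with
  | self => simp
  | of_succ i hi ih =>
    rw [show N - i = (N - (i + 1)) + 1 by omega, chain_succ]
    rcases eq_or_ne (i + 1) N with rfl | h
    · rw [Nat.sub_self, chain_zero, R.lie_symm (X i)]
      exact R.cubic i rfl
    · have hc := R.comm' N i (by omega)
      rw [leibniz_lie (X N) (X i), hc, zero_lie, zero_add, leibniz_lie (X N) (X i), hc, zero_lie,
        zero_add, ih, lie_zero]

/-- The chain from `j` to `N - 1` acts like a root vector for `e_j - e_N`: it moves `c_N = X_N` to
`c_j` and kills the other maximal chains. -/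
lemma lie_chain_full (j i : ℕ) (hj : j < N) (hi : i ≤ N) :
    ⁅chain X j (N - 1 - j), chain X i (N - i)⁆ = if i = N then chain X j (N - j) else 0 := by
  obtain ⟨d, hd⟩ : ∃ d, N - 1 - j = d := ⟨_, rfl⟩
  induction d generalizing j i with
  | zero =>
    obtain rfl : N = j + 1 := by omega
    rw [hd, chain_zero, R.lie_full _ _ hj hi]
    simp only [eq_comm]
  | succ d ih =>
    have e (i : ℕ) (hi : i ≤ N) := ih (j + 1) i (by omega) hi (by omega)
    rw [show N - 1 - (j + 1) = d by omega] at e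
    rw [hd, chain_succ, lie_lie, e i hi, R.lie_full _ _ hj hi]
    rcases eq_or_ne i N with rfl | h
    · rw [if_pos rfl, if_pos rfl, if_neg (by omega), lie_zero, sub_zero,
        R.lie_full _ _ hj (by omega), if_pos rfl]
    · rw [if_neg h, if_neg h, lie_zero, zero_sub, R.neg_eq]
      split_ifs
      · rw [e j hj.le, if_neg hj.ne]
      · exact lie_zero _

/-- For `i, j < N`, apply the derivation `D`, the bracket with the chain from `i` to `N - 1`, to
`[X_N, [X_N, c_j]] = 0`. As `D X_N = c_i` and `D c_j = 0`, this gives `[c_i, [X_N, c_j]] = [X_N,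
[c_i, c_j]]`. The two Jacobi terms of `[X_N, [c_i, c_j]]` are then equal and cancel in
characteristic two. -/
lemma lie_last_lie_full (i j : ℕ) (hi : i ≤ N) (hj : j ≤ N) :
    ⁅X N, ⁅chain X i (N - i), chain X j (N - j)⁆⁆ = 0 := by
  have e0 (i : ℕ) (hi : i < N) : ⁅chain X i (N - 1 - i), X N⁆ = chain X i (N - i) := by
    simpa using R.lie_chain_full i N hi le_rfl
  have swap (i j : ℕ) (hi : i < N) (hj : j < N) :
      ⁅chain X i (N - i), ⁅X N, chain X j (N - j)⁆⁆ =
        ⁅X N, ⁅chain X i (N - i), chain X j (N - j)⁆⁆ := by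
    have h := congrArg (fun z => ⁅chain X i (N - 1 - i), z⁆) (R.lie_lie_last_full j hj.le)
    simp only [lie_zero] at h
    rw [leibniz_lie (chain X i (N - 1 - i)) (X N), e0 i hi,
      leibniz_lie (chain X i (N - 1 - i)) (X N), e0 i hi, R.lie_chain_full i j hi hj.le,
      if_neg hj.ne, lie_zero, add_zero] at h
    rw [eq_neg_of_add_eq_zero_left h, R.neg_eq]
  rcases hi.eq_or_lt with rfl | hi
  · simpa using R.lie_lie_last_full j hj
  rcases hj.eq_or_lt with rfl | hj
  · rw [R.lie_symm (chain X i _)]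
    simpa using R.lie_lie_last_full i hi.le
  rw [leibniz_lie, R.lie_symm ⁅X N, _⁆, swap _ _ hi hj, swap _ _ hj hi,
    R.lie_symm (chain X j _), R.two]

end Relations

variable (K : Type*) [Field K] [LieAlgebra K L]

/-- The span of the chains and of the brackets of two maximal chains. -/
def chainSpan (X : ℕ → L) (N : ℕ) : Submodule K L :=
  Submodule.span K ({z | ∃ i d, z = chain X i d} ∪
    {z | ∃ i j, i ≤ N ∧ j ≤ N ∧ z = ⁅chain X i (N - i), chain X j (N - j)⁆})

variable {K} in
lemma Relations.lie_mem_chainSpan {X : ℕ → L} {N : ℕ} (R : Relations X N) (k : ℕ) {z : L}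
    (hz : z ∈ chainSpan K X N) : ⁅X k, z⁆ ∈ chainSpan K X N := by
  have hc (i d : ℕ) : chain X i d ∈ chainSpan K X N :=
    Submodule.subset_span (Or.inl ⟨i, d, rfl⟩)
  have hg (i j : ℕ) (hi : i ≤ N) (hj : j ≤ N) :
      ⁅chain X i (N - i), chain X j (N - j)⁆ ∈ chainSpan K X N :=
    Submodule.subset_span (Or.inr ⟨i, j, hi, hj, rfl⟩)
  induction hz using Submodule.span_induction with
  | zero => rw [lie_zero]; exact zero_mem _
  | add a b _ _ ha hb => rw [lie_add]; exact add_mem ha hb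
  | smul c a _ ha => rw [lie_smul]; exact Submodule.smul_mem _ _ ha
  | mem z hz =>
    rcases hz with ⟨i, d, rfl⟩ | ⟨i, j, hi, hj, rfl⟩
    · by_cases h : k ≠ N ∨ i + d ≠ N
      · rw [R.lie_chain_mem _ _ _ h]
        split_ifs
        exacts [hc _ _, hc _ _, zero_mem _]
      -- Here `X N` is itself the maximal chain `c_N`.
      · obtain ⟨rfl, rfl⟩ : k = N ∧ d = N - i := by omega
        simpa using hg k i le_rfl (by omega)
    · rcases lt_trichotomy k N with hk | rfl | hk
      · rw [leibniz_lie, R.lie_full _ _ hk hi, R.lie_full _ _ hk hj]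
        refine add_mem ?_ ?_
        · split_ifs
          · exact hg _ _ hk.le hj
          · rw [zero_lie]; exact zero_mem _
        · split_ifs
          · exact hg _ _ hi hk.le
          · rw [lie_zero]; exact zero_mem _
      · rw [R.lie_last_lie_full _ _ hi hj]; exact zero_mem _
      · rw [R.vanish _ hk, zero_lie]; exact zero_mem _

/-- A subspace that contains a generating set of a Lie algebra and is stable under the adjoint
action of its elements is everything. -/
lemma eq_top_of_lie_mem {s : Set L} (hs : LieSubalgebra.lieSpan K L s = ⊤) (S : Submodule K L)
    (hsS : s ⊆ S) (h : ∀ a ∈ s, ∀ z ∈ S, ⁅a, z⁆ ∈ S) : S = ⊤ := by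
  have hall (a : L) : ∀ z ∈ S, ⁅a, z⁆ ∈ S := by
    have ha : a ∈ LieSubalgebra.lieSpan K L s := hs ▸ LieSubalgebra.mem_top a
    induction ha using LieSubalgebra.lieSpan_induction with
    | mem a ha => exact h a ha
    | zero => intro z _; rw [zero_lie]; exact zero_mem _
    | smul c a _ ha => intro z hz; rw [smul_lie]; exact S.smul_mem _ (ha z hz)
    | add a b _ _ ha hb => intro z hz; rw [add_lie]; exact add_mem (ha z hz) (hb z hz)
    | lie a b _ _ ha hb =>
      intro z hz
      rw [lie_lie]
      exact sub_mem (ha _ (hb z hz)) (hb _ (ha z hz))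
  rw [eq_top_iff]
  intro a _
  have ha : a ∈ LieSubalgebra.lieSpan K L s := hs ▸ LieSubalgebra.mem_top a
  have hle : LieSubalgebra.lieSpan K L s ≤ { S with lie_mem' := fun {a b} _ hb => hall a b hb } :=
    LieSubalgebra.lieSpan_le.2 hsS
  exact hle ha

variable {K} in
lemma Relations.chainSpan_eq_top {X : ℕ → L} {N : ℕ} (R : Relations X N)
    (hX : LieSubalgebra.lieSpan K L (Set.range X) = ⊤) : chainSpan K X N = ⊤ := by
  refine eq_top_of_lie_mem K hX _ ?_ ?_
  · rintro _ ⟨k, rfl⟩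
    exact Submodule.subset_span (Or.inl ⟨k, 0, rfl⟩)
  · rintro _ ⟨k, rfl⟩ z hz
    exact R.lie_mem_chainSpan k hz

end Strings

open Matrix

/-! ### Root matrices and the Chevalley relations -/

section RootVectors

variable {n : ℕ}

/-- The involution of the positions that belongs to the form: it exchanges the outer blocks. -/
def bar : Idx n → Idx n
  | Sum.inl i => lst i
  | Sum.inr (Sum.inl _) => mid
  | Sum.inr (Sum.inr i) => fst i

@[simp] lemma bar_fst (i : Fin n) : bar (fst i) = lst i := rfl
@[simp] lemma bar_mid : bar (mid : Idx n) = mid := rfl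
@[simp] lemma bar_lst (i : Fin n) : bar (lst i) = fst i := rfl

@[simp] lemma bar_bar (a : Idx n) : bar (bar a) = a := by
  rcases a with i | ⟨⟩ | i <;> rfl

lemma bar_involutive : Function.Involutive (bar : Idx n → Idx n) := bar_bar

lemma bar_injective : Function.Injective (bar : Idx n → Idx n) :=
  bar_involutive.injective

lemma bar_eq_iff {a b : Idx n} : bar a = b ↔ a = bar b :=
  ⟨fun h => by rw [← h, bar_bar], fun h => by rw [h, bar_bar]⟩

variable (K : Type*) [Field K]

/-- The matrix `E_{a,b} + E_{b',a'}`. -/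
def rootMat (a b : Idx n) : Matrix (Idx n) (Idx n) K := single a b 1 + single (bar b) (bar a) 1

variable {K}

lemma rootMat_bar (a b : Idx n) : rootMat K (bar a) (bar b) = rootMat K b a := by
  rw [rootMat, rootMat, bar_bar, bar_bar, add_comm]

lemma rootMat_apply (a b c d : Idx n) : rootMat K a b c d =
    (if a = c ∧ b = d then 1 else 0) + (if bar b = c ∧ bar a = d then 1 else 0) := by
  simp [rootMat, single_apply]

lemma rootMat_transpose (a b : Idx n) : (rootMat K a b)ᵀ = rootMat K b a := by
  ext c d
  simp only [transpose_apply, rootMat_apply, and_comm]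

lemma single_mul_single_ite (a b c d : Idx n) :
    (single a b 1 * single c d 1 : Matrix (Idx n) (Idx n) K) = if b = c then single a d 1 else 0 := by
  split_ifs with h
  · subst h; simp
  · exact single_mul_single_of_ne _ _ _ _ h _

/-- The position with number `m`, counted from zero, in the first two blocks; the middle one if
`n ≤ m`. -/
def pos (n m : ℕ) : Idx n := if h : m < n then fst ⟨m, h⟩ else mid

lemma pos_of_lt {m : ℕ} (h : m < n) : pos n m = fst ⟨m, h⟩ := dif_pos h

lemma pos_val (i : Fin n) : pos n i = fst i := pos_of_lt i.isLt

lemma pos_of_le {m : ℕ} (h : n ≤ m) : pos n m = mid := dif_neg (by omega)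

lemma pos_eq_pos {a b : ℕ} : pos n a = pos n b ↔ a = b ∨ (n ≤ a ∧ n ≤ b) := by
  unfold pos
  split_ifs <;> simp <;> omega

lemma pos_eq_bar_pos {a b : ℕ} : pos n a = bar (pos n b) ↔ n ≤ a ∧ n ≤ b := by
  unfold pos
  split_ifs <;> simp <;> omega

lemma x_eq (i : Fin n) : x K n i = rootMat K (pos n i) (pos n (i + 1)) := by
  unfold x
  rw [pos_val]
  split_ifs with h
  · rw [pos_of_lt h]; rfl
  · rw [pos_of_le (by omega)]; rfl

lemma y_eq (i : Fin n) : y K n i = rootMat K (pos n (i + 1)) (pos n i) := by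
  rw [y, x_eq, rootMat_transpose]

variable [CharP K 2]

lemma matrix_add_self (M : Matrix (Idx n) (Idx n) K) : M + M = 0 := by
  ext a b; exact CharTwo.add_self_eq_zero _

lemma matrix_sub (M N : Matrix (Idx n) (Idx n) K) : M - N = M + N := by
  ext a b; exact CharTwo.sub_eq_add _ _

lemma rootMat_self_bar (a : Idx n) : rootMat K a (bar a) = 0 := by
  rw [rootMat, bar_bar, matrix_add_self]

@[simp] lemma rootMat_mid_mid : rootMat K (mid : Idx n) mid = 0 := rootMat_self_bar mid

/-- In characteristic two the commutator is a sum of eight products of matrix units, which `bar`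
pairs into four root matrices. -/
lemma lie_rootMat (a b c d : Idx n) : ⁅rootMat K a b, rootMat K c d⁆ =
    (if b = c then rootMat K a d else 0) + (if b = bar d then rootMat K a (bar c) else 0) +
    (if a = bar c then rootMat K (bar b) d else 0) +
    (if a = d then rootMat K (bar b) (bar c) else 0) := by
  rw [LieRing.of_associative_ring_bracket, matrix_sub]
  simp only [rootMat, add_mul, mul_add, single_mul_single_ite, bar_bar, bar_injective.eq_iff]
  simp only [eq_comm (a := d), eq_comm (a := c), bar_eq_iff]
  simp only [← bar_eq_iff (a := a)]
  split_ifs <;> simp_all <;> abel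

lemma lie_rootMat_mid (a b : Idx n) (ha : a ≠ mid) (hb : b ≠ mid) :
    ⁅rootMat K a mid, rootMat K mid b⁆ = rootMat K a b := by
  rw [lie_rootMat, if_pos rfl, if_neg (by rw [ne_comm, ← bar_injective.ne_iff] at hb; simpa using hb),
    if_neg (by simpa using ha)]
  split_ifs with h
  · subst h; simp
  · simp

lemma h_eq (i : Fin n) : h K n i =
    rootMat K (pos n i) (pos n i) + rootMat K (pos n (i + 1)) (pos n (i + 1)) := by
  unfold h
  rw [pos_val]
  split_ifs with h
  · rw [pos_of_lt h]
    simp only [rootMat, bar_fst]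
    abel
  · rw [pos_of_le (by omega), rootMat_mid_mid, add_zero]; rfl

lemma lie_x_y (i j : Fin n) : ⁅x K n i, y K n j⁆ = if i = j then h K n i else 0 := by
  rw [x_eq, y_eq, h_eq, lie_rootMat]
  simp only [pos_eq_pos, pos_eq_bar_pos, Fin.ext_iff]
  rw [if_neg (by omega : ¬ (n ≤ i.val + 1 ∧ n ≤ j.val)), if_neg (by omega : ¬ (n ≤ i.val ∧ _)),
    add_zero, add_zero]
  split_ifs with h1 h2 h3
  · obtain rfl : i = j := Fin.ext (by omega)
    rw [rootMat_bar]
  all_goals first | omega | simp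

lemma lie_rootMat_diag (a b c : ℕ) (hc : c < n) :
    ⁅rootMat K (pos n c) (pos n c), rootMat K (pos n a) (pos n b)⁆ =
      ((if c = a then 1 else 0) + if c = b then 1 else 0 : K) • rootMat K (pos n a) (pos n b) := by
  rw [lie_rootMat, rootMat_bar]
  simp only [pos_eq_pos, pos_eq_bar_pos]
  simp only [hc.not_ge, false_and, or_false, if_false, add_zero, add_smul, ite_smul, one_smul,
    zero_smul]
  congr 1
  · exact ite_congr rfl (fun h => by rw [h]) fun _ => rfl
  · exact ite_congr rfl (fun h => by rw [h]) fun _ => rfl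

lemma lie_h_x (i j : Fin n) : ⁅h K n i, x K n j⁆ = cartan K n i j • x K n j := by
  have two : (1 + 1 : K) = 0 := CharTwo.add_self_eq_zero 1
  rw [h_eq, x_eq, add_lie, lie_rootMat_diag _ _ _ i.isLt]
  simp only [cartan, Fin.ext_iff]
  rcases Nat.lt_or_ge (i + 1) n with hi | hi
  · rw [lie_rootMat_diag _ _ _ hi, ← add_smul]
    congr 1
    split_ifs <;> first | omega | simp [two]
  · rw [pos_of_le hi, rootMat_mid_mid, zero_lie, add_zero]
    congr 1
    split_ifs <;> first | omega | simp

/-- Transpose of `lie_h_x`: the matrix `h` is symmetric, and transposition reverses brackets. -/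
lemma lie_h_y (i j : Fin n) : ⁅h K n i, y K n j⁆ = -(cartan K n i j • y K n j) := by
  have hT : (h K n i)ᵀ = h K n i := by
    rw [h_eq, Matrix.transpose_add, rootMat_transpose, rootMat_transpose]
  rw [← neg_eq_iff_eq_neg, lie_skew, y, ← Matrix.transpose_smul, ← lie_h_x, Matrix.lie_transpose,
    hT]

lemma lie_h_h (i j : Fin n) : ⁅h K n i, h K n j⁆ = 0 := by
  have key (a b : ℕ) : ⁅rootMat K (pos n a) (pos n a), rootMat K (pos n b) (pos n b)⁆ = 0 := by
    rcases Nat.lt_or_ge a n with ha | ha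
    · rw [lie_rootMat_diag _ _ _ ha, ← two_mul, CharTwo.two_eq_zero, zero_mul, zero_smul]
    · rw [pos_of_le ha, rootMat_mid_mid, zero_lie]
  rw [h_eq, h_eq, add_lie, lie_add, lie_add, key, key, key, key]
  simp

end RootVectors

/-! ### The derived algebra and its generation -/

section Derived

variable (K : Type*) [Field K] (n : ℕ)

lemma gram_apply (a b : Idx n) : gram K n a b = if a = bar b then 1 else 0 := by
  rcases a with a | ⟨⟩ | a <;> rcases b with b | ⟨⟩ | b <;>
    simp [gram, Matrix.sum_apply, single_apply, bar, ite_and]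

variable {K n}

lemma mem_orthDerived {M : Matrix (Idx n) (Idx n) K} : M ∈ orthDerived K n ↔
    M ∈ Submodule.span K {z | ∃ A ∈ orth K n, ∃ B ∈ orth K n, ⁅A, B⁆ = z} := by
  have e : (LieAlgebra.derivedSeries K (orth K n) 1).toSubmodule =
      Submodule.span K {z | ∃ A B : orth K n, ⁅A, B⁆ = z} := by
    rw [LieAlgebra.derivedSeries_def, LieAlgebra.derivedSeriesOfIdeal_succ,
      LieAlgebra.derivedSeriesOfIdeal_zero, LieSubmodule.lieIdeal_oper_eq_linear_span']
    simp
  have e' : (orthDerived K n).toSubmodule = (LieAlgebra.derivedSeries K (orth K n) 1).toSubmodule.map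
      (orth K n).toSubmodule.subtype := rfl
  rw [← LieSubalgebra.mem_toSubmodule, e', e, Submodule.map_span]
  have : (orth K n).toSubmodule.subtype '' {z | ∃ A B : orth K n, ⁅A, B⁆ = z} =
      {z | ∃ A ∈ orth K n, ∃ B ∈ orth K n, ⁅A, B⁆ = z} := by
    ext z
    constructor
    · rintro ⟨_, ⟨A, B, rfl⟩, rfl⟩
      exact ⟨A, A.2, B, B.2, rfl⟩
    · rintro ⟨A, hA, B, hB, rfl⟩
      exact ⟨_, ⟨⟨A, hA⟩, ⟨B, hB⟩, rfl⟩, rfl⟩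
  exact this ▸ Iff.rfl

variable [CharP K 2]

lemma mem_orth {M : Matrix (Idx n) (Idx n) K} :
    M ∈ orth K n ↔ ∀ a b, M (bar a) b = M (bar b) a := by
  have e1 (a b : Idx n) : (Mᵀ * gram K n) a b = M (bar b) a := by
    simp [Matrix.mul_apply, gram_apply]
  have e2 (a b : Idx n) : (gram K n * M) a b = M (bar a) b := by
    simp [Matrix.mul_apply, gram_apply, ← bar_eq_iff]
  rw [orth, mem_skewAdjointMatricesLieSubalgebra, mem_skewAdjointMatricesSubmodule,
    Matrix.IsSkewAdjoint, Matrix.IsAdjointPair, ← Matrix.ext_iff]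
  simp only [e1, e2, CharTwo.neg_eq]
  exact forall₂_congr fun a b => eq_comm

lemma rootMat_mem_orth (a b : Idx n) : rootMat K a b ∈ orth K n := by
  rw [mem_orth]
  intro c d
  simp only [rootMat_apply, bar_injective.eq_iff, ← bar_eq_iff]
  simp only [add_comm, and_comm]

lemma lie_apply_bar_self {M N : Matrix (Idx n) (Idx n) K} (hM : M ∈ orth K n) (hN : N ∈ orth K n)
    (a : Idx n) : ⁅M, N⁆ (bar a) a = 0 := by
  rw [mem_orth] at hM hN
  rw [LieRing.of_associative_ring_bracket, Matrix.sub_apply, Matrix.mul_apply, Matrix.mul_apply,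
    sub_eq_zero]
  -- The substitution `c ↦ bar c` turns the diagonal sum for `MN` into that for `NM`, by the
  -- symmetry of both matrices.
  refine Fintype.sum_bijective bar bar_involutive.bijective _ _ fun c => ?_
  rw [hN a (bar c), bar_bar, hM c a, mul_comm]

lemma mem_span_rootMat {M : Matrix (Idx n) (Idx n) K} (hM : M ∈ orth K n)
    (h0 : ∀ a, M (bar a) a = 0) :
    M ∈ Submodule.span K (Set.range fun p : Idx n × Idx n => rootMat K p.1 p.2) := by
  rw [mem_orth] at hM
  -- An arbitrary numbering, used to take each unordered pair `{a, b}` once; the pairs with `a = b`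
  -- carry the vanishing entries.
  let r := Fintype.equivFin (Idx n)
  have key : M = ∑ a, ∑ b, (if r a < r b then M (bar a) b else 0) • rootMat K (bar a) b := by
    ext c d
    obtain ⟨c, rfl⟩ : ∃ c', c = bar c' := ⟨bar c, (bar_bar c).symm⟩
    simp only [Matrix.sum_apply, Matrix.smul_apply, rootMat_apply, bar_bar, smul_eq_mul, mul_add,
      Finset.sum_add_distrib, bar_injective.eq_iff, mul_ite, mul_one, mul_zero, ite_and,
      Finset.sum_ite_eq', Finset.mem_univ, if_true]
    have e : (∑ x, ∑ y, if x = c then if y = d then if r x < r y then M (bar x) y else 0 else 0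
        else 0) = if r c < r d then M (bar c) d else 0 := by
      rw [Finset.sum_eq_single c (fun x _ hx => by simp [hx]) (by simp)]
      simp
    rw [e]
    rcases lt_trichotomy (r c) (r d) with h | h | h
    · rw [if_pos h, if_neg h.not_gt, add_zero]
    · rw [if_neg (by rw [h]; exact lt_irrefl _), if_neg (by rw [h]; exact lt_irrefl _),
        r.injective h, h0, add_zero]
    · rw [if_neg h.not_gt, if_pos h, zero_add, hM]
  rw [key]
  exact Submodule.sum_mem _ fun a _ => Submodule.sum_mem _ fun b _ =>
    Submodule.smul_mem _ _ (Submodule.subset_span ⟨(bar a, b), rfl⟩)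

lemma rootMat_mem_lieSpan (a b : Idx n) :
    rootMat K a b ∈ LieSubalgebra.lieSpan K _ (Set.range (x K n) ∪ Set.range (y K n)) := by
  set S := LieSubalgebra.lieSpan K (Matrix (Idx n) (Idx n) K)
    (Set.range (x K n) ∪ Set.range (y K n))
  have hx (i : Fin n) : rootMat K (pos n i) (pos n (i + 1)) ∈ S :=
    x_eq (K := K) i ▸ LieSubalgebra.subset_lieSpan (Or.inl ⟨i, rfl⟩)
  have hy (i : Fin n) : rootMat K (pos n (i + 1)) (pos n i) ∈ S :=
    y_eq (K := K) i ▸ LieSubalgebra.subset_lieSpan (Or.inr ⟨i, rfl⟩)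
  have hpos (m : ℕ) (hm : m ≤ n) : rootMat K (pos n m) mid ∈ S ∧ rootMat K mid (pos n m) ∈ S := by
    induction hm using Nat.decreasingInduction with
    | self => rw [pos_of_le le_rfl, rootMat_mid_mid]; exact ⟨zero_mem _, zero_mem _⟩
    | of_succ m hm ih =>
      rcases Nat.lt_or_ge (m + 1) n with h | h
      · have e1 := S.lie_mem (hx ⟨m, hm⟩) ih.1
        have e2 := S.lie_mem ih.2 (hy ⟨m, hm⟩)
        -- Reading `mid` as `pos n n` turns all equalities of positions into arithmetic.
        rw [← pos_of_le le_rfl, lie_rootMat] at e1 e2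
        simp only [pos_eq_pos, pos_eq_bar_pos] at e1 e2
        rw [← pos_of_le le_rfl]
        constructor
        · convert e1 using 1
          split_ifs <;> first | omega | simp
        · convert e2 using 1
          split_ifs <;> first | omega | simp
      · have e1 := hx ⟨m, hm⟩
        have e2 := hy ⟨m, hm⟩
        rw [pos_of_le h] at e1 e2
        exact ⟨e1, e2⟩
  have hmid (a : Idx n) : rootMat K a mid ∈ S ∧ rootMat K mid a ∈ S := by
    rcases a with i | ⟨⟩ | i
    · simpa only [pos_val] using hpos i i.isLt.le
    · exact (rootMat_mid_mid (K := K) (n := n)).symm ▸ ⟨zero_mem _, zero_mem _⟩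
    · have := hpos i i.isLt.le
      rw [pos_val, ← rootMat_bar, ← rootMat_bar (fst i) mid] at this
      exact this.symm
  by_cases ha : a = mid
  · exact ha ▸ (hmid b).2
  by_cases hb : b = mid
  · exact hb ▸ (hmid a).1
  rw [← lie_rootMat_mid a b ha hb]
  exact S.lie_mem (hmid a).1 (hmid b).2

lemma lieSpan_eq_orthDerived :
    LieSubalgebra.lieSpan K _ (Set.range (x K n) ∪ Set.range (y K n)) = orthDerived K n := by
  apply le_antisymm
  -- A diagonal element of `orth` meeting exactly one of the two indices acts with eigenvalue 1, so
  -- the root matrix is a commutator.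
  · have hd (i : Fin n) (a b : ℕ) (hab : (i = a ∧ i ≠ b) ∨ (i ≠ a ∧ i = b)) :
        rootMat K (pos n a) (pos n b) ∈ orthDerived K n := by
      rw [mem_orthDerived]
      refine Submodule.subset_span ⟨_, rootMat_mem_orth (pos n i) (pos n i), _,
        rootMat_mem_orth (pos n a) (pos n b), ?_⟩
      rw [lie_rootMat_diag _ _ _ i.isLt]
      rcases hab with ⟨h1, h2⟩ | ⟨h1, h2⟩
      · rw [if_pos h1, if_neg h2, add_zero, one_smul]
      · rw [if_neg h1, if_pos h2, zero_add, one_smul]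
    rw [LieSubalgebra.lieSpan_le]
    rintro _ (⟨i, rfl⟩ | ⟨i, rfl⟩)
    · rw [x_eq]; exact hd i _ _ (by omega)
    · rw [y_eq]; exact hd i _ _ (by omega)
  · intro M hM
    rw [mem_orthDerived] at hM
    refine Submodule.span_le (p := (LieSubalgebra.lieSpan K _ _).toSubmodule) |>.2 ?_ hM
    rintro _ ⟨A, hA, B, hB, rfl⟩
    refine Submodule.span_le.2 ?_
      (mem_span_rootMat ((orth K n).lie_mem hA hB) (lie_apply_bar_self hA hB))
    rintro _ ⟨p, rfl⟩
    exact rootMat_mem_lieSpan _ _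

end Derived

/-! ### The presented algebra and the relations on sequences -/

section Presentation

variable {K : Type*} [Field K] {n : ℕ}

/-- A finite sequence, extended by zeros. -/
def extend {L : Type*} [Zero L] (a : Fin n → L) (k : ℕ) : L := if h : k < n then a ⟨k, h⟩ else 0

lemma extend_of_lt {L : Type*} [Zero L] (a : Fin n → L) {k : ℕ} (h : k < n) :
    extend a k = a ⟨k, h⟩ := dif_pos h

lemma extend_of_le {L : Type*} [Zero L] (a : Fin n → L) {k : ℕ} (h : n ≤ k) :
    extend a k = 0 := dif_neg (by omega)

lemma lieSpan_range_extend {L : Type*} [LieRing L] [LieAlgebra K L] (a : Fin n → L)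
    (ha : LieSubalgebra.lieSpan K L (Set.range a) = ⊤) :
    LieSubalgebra.lieSpan K L (Set.range (extend a)) = ⊤ := by
  rw [eq_top_iff, ← ha]
  refine LieSubalgebra.lieSpan_mono ?_
  rintro _ ⟨i, rfl⟩
  exact ⟨i, extend_of_lt a i.isLt⟩

lemma serreExponent_cartan {k j : Fin n} (hkj : k ≠ j) : serreExponent (cartan K n) k j =
    if k.val + 1 = j.val ∨ j.val + 1 = k.val then (if k.val + 1 = n then 2 else 1) else 0 := by
  have hkj' : k.val ≠ j.val := fun h => hkj (Fin.ext h)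
  have hk : cartan K n k k = if k.val + 1 = n then 1 else 0 := by
    unfold cartan; congr 1; simp
  have h1 : cartan K n k j = if k.val + 1 = j.val ∨ j.val + 1 = k.val then 1 else 0 := by
    unfold cartan; congr 1; simp [hkj]
  have h2 : cartan K n j k = if k.val + 1 = j.val ∨ j.val + 1 = k.val then 1 else 0 := by
    unfold cartan; congr 1; simp [hkj.symm, or_comm]
  unfold serreExponent
  by_cases hb : k.val + 1 = n
  · rw [if_pos hb] at hk ⊢
    rw [hk, if_neg one_ne_zero, h2]
    by_cases ha : k.val + 1 = j.val ∨ j.val + 1 = k.val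
    · rw [if_pos ha, if_pos ha, if_pos rfl]
    · rw [if_neg ha, if_neg ha, if_neg zero_ne_one]
  · rw [if_neg hb] at hk ⊢
    rw [if_pos hk, h1]
    by_cases ha : k.val + 1 = j.val ∨ j.val + 1 = k.val
    · rw [if_pos ha, if_pos ha, if_neg one_ne_zero]
    · rw [if_neg ha, if_neg ha, if_pos rfl]

section

variable {L : Type*} [LieRing L] [LieAlgebra K L] (u v : L)

lemma ad_pow_one : ((LieAlgebra.ad K L u) ^ (1 + 0)) v = ⁅u, v⁆ := by simp

lemma ad_pow_two : ((LieAlgebra.ad K L u) ^ (1 + 1)) v = ⁅u, ⁅u, v⁆⁆ := by simp [pow_succ]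

lemma ad_pow_three : ((LieAlgebra.ad K L u) ^ (1 + 2)) v = ⁅u, ⁅u, ⁅u, v⁆⁆⁆ := by
  simp [pow_succ]

end

/-- A homomorphism from the free Lie algebra kills the relators if and only if the images of the
generators satisfy the relations. -/
lemma forall_relators_iff {L : Type*} [LieRing L] [LieAlgebra K L] (hL : ∀ a : L, a + a = 0)
    (f : FreeLieAlgebra K (Fin n) →ₗ⁅K⁆ L) :
    (∀ r ∈ serreRelators K n ∪ nonSerreRelators K n, f r = 0) ↔
      Relations (extend fun i => f (FreeLieAlgebra.of K i)) (n - 1) := by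
  set X := extend fun i => f (FreeLieAlgebra.of K i) with hX
  have hXi (i : Fin n) : f (FreeLieAlgebra.of K i) = X i :=
    (extend_of_lt (fun i => f (FreeLieAlgebra.of K i)) i.isLt).symm
  have hX0 (k : ℕ) (hk : n ≤ k) : X k = 0 := extend_of_le _ hk
  have hsymm (a b : L) : ⁅a, b⁆ = ⁅b, a⁆ := by
    rw [← lie_skew]; exact neg_eq_of_add_eq_zero_left (hL _)
  have serre : (∀ r ∈ serreRelators K n, f r = 0) ↔ ∀ k j : Fin n, k ≠ j →
      ((LieAlgebra.ad K L (X k)) ^ (1 + serreExponent (cartan K n) k j)) (X j) = 0 := by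
    have hf (u v : FreeLieAlgebra K (Fin n)) (m : ℕ) :
        f (((LieAlgebra.ad K _ u) ^ m) v) = ((LieAlgebra.ad K L (f u)) ^ m) (f v) := by
      induction m with
      | zero => rfl
      | succ m ih => rw [pow_succ', pow_succ', Module.End.mul_apply, Module.End.mul_apply,
          LieAlgebra.ad_apply, LieAlgebra.ad_apply, LieHom.map_lie, ih]
    constructor
    · intro H k j hkj
      rw [← hXi, ← hXi, ← hf]
      exact H _ ⟨k, j, hkj, rfl⟩
    · rintro H _ ⟨k, j, hkj, rfl⟩
      rw [hf, hXi, hXi, H k j hkj]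
  have cubic : (∀ r ∈ nonSerreRelators K n, f r = 0) ↔
      ∀ k, ⁅⁅X k, X (k + 1)⁆, ⁅X (k + 1), X (k + 2)⁆⁆ = 0 := by
    constructor
    · intro H k
      rcases Nat.lt_or_ge (k + 2) n with h | h
      · have := H _ ⟨⟨k, by omega⟩, ⟨k + 1, by omega⟩, ⟨k + 2, h⟩, rfl, rfl, rfl⟩
        simpa only [LieHom.map_lie, hXi] using this
      · rw [hX0 _ h, lie_zero, lie_zero]
    · rintro H _ ⟨a, b, c, hab, hbc, rfl⟩
      simp only [LieHom.map_lie, hXi, ← hbc, ← hab]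
      exact H a
  have hunion : (∀ r ∈ serreRelators K n ∪ nonSerreRelators K n, f r = 0) ↔
      (∀ r ∈ serreRelators K n, f r = 0) ∧ ∀ r ∈ nonSerreRelators K n, f r = 0 := by
    simp only [Set.mem_union, or_imp, forall_and]
  rw [hunion, serre, cubic]
  constructor
  · rintro ⟨H, Hc⟩
    have H' (k j : ℕ) (hkj : k ≠ j) (hk : k < n) (hj : j < n) :
        ((LieAlgebra.ad K L (X k)) ^ (1 + if k + 1 = j ∨ j + 1 = k then
          (if k + 1 = n then 2 else 1) else 0)) (X j) = 0 := by
      have hne : (⟨k, hk⟩ : Fin n) ≠ ⟨j, hj⟩ := fun h => hkj (congrArg Fin.val h)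
      have := H ⟨k, hk⟩ ⟨j, hj⟩ hne
      rwa [serreExponent_cartan hne] at this
    -- Relations that involve an index beyond `n - 1` hold because the extended sequence vanishes
    -- there.
    exact
      { two := hL
        vanish := fun k hk => hX0 k (by omega)
        comm := fun k j hkj => by
          rcases Nat.lt_or_ge j n with hj | hj
          · have := H' k j (by omega) (by omega) hj
            rwa [if_neg (by omega), ad_pow_one] at this
          · rw [hX0 _ hj, lie_zero]
        serre_up := fun k hk => by
          rcases Nat.lt_or_ge (k + 1) n with h | h
          · have := H' k (k + 1) (by omega) (by omega) h
            rwa [if_pos (by omega), if_neg (by omega), ad_pow_two] at this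
          · rw [hX0 _ h, lie_zero, lie_zero]
        serre_down := fun k hk => by
          rcases Nat.lt_or_ge (k + 1) n with h | h
          · have := H' (k + 1) k (by omega) (by omega) (by omega)
            rwa [if_pos (by omega), if_neg (by omega), ad_pow_two] at this
          · rw [hX0 _ h, zero_lie]
        cubic := fun k hk => by
          have := H' (k + 1) k (by omega) (by omega) (by omega)
          rwa [if_pos (by omega), if_pos (by omega), ad_pow_three] at this
        nonSerre := Hc }
  · intro R
    refine ⟨fun k j hkj => ?_, R.nonSerre⟩
    have hkj' : k.val ≠ j.val := fun h => hkj (Fin.ext h)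
    rw [serreExponent_cartan hkj]
    split_ifs with h1 h2
    · rw [ad_pow_three, show k.val = j.val + 1 by omega]
      exact R.cubic j (by omega)
    · rw [ad_pow_two]
      rcases h1 with h1 | h1
      · rw [← h1]
        exact R.serre_up k (by omega)
      · rw [← h1]
        exact R.serre_down j (by omega)
    · rw [ad_pow_one]
      rcases Nat.lt_or_ge k j with h | h
      · exact R.comm _ _ (by omega)
      · exact R.comm' _ _ (by omega)

/-- The linear combination of chains, and of brackets of maximal chains, with the entries of a
matrix as coefficients. -/
def combine {L : Type*} [LieRing L] [LieAlgebra K L] (X : ℕ → L) :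
    Matrix (Idx n) (Idx n) K →ₗ[K] L :=
  (∑ i : Fin n, ∑ j : Fin n, (Matrix.entryLinearMap K K (fst i) (fst j)).smulRight
      (if i < j then chain X i (j - i - 1) else 0)) +
  (∑ i : Fin n, (Matrix.entryLinearMap K K (fst i) mid).smulRight (chain X i (n - 1 - i))) +
  ∑ i : Fin n, ∑ j : Fin n, (Matrix.entryLinearMap K K (fst i) (lst j)).smulRight
      (if i < j then ⁅chain X i (n - 1 - i), chain X j (n - 1 - j)⁆ else 0)

lemma combine_apply {L : Type*} [LieRing L] [LieAlgebra K L] (X : ℕ → L)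
    (M : Matrix (Idx n) (Idx n) K) : combine X M =
      (∑ i : Fin n, ∑ j : Fin n, M (fst i) (fst j) •
        (if i < j then chain X i (j - i - 1) else 0)) +
      (∑ i : Fin n, M (fst i) mid • chain X i (n - 1 - i)) +
      ∑ i : Fin n, ∑ j : Fin n, M (fst i) (lst j) •
        (if i < j then ⁅chain X i (n - 1 - i), chain X j (n - 1 - j)⁆ else 0) := by
  simp [combine, LinearMap.add_apply, LinearMap.sum_apply]

lemma sum_sum_ite_smul {L : Type*} [AddCommGroup L] [Module K L] (i j : Fin n)
    (v : Fin n → Fin n → L) :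
    ∑ a, ∑ b, (if i = a ∧ j = b then (1 : K) else 0) • v a b = v i j := by
  simp only [ite_smul, one_smul, zero_smul, ite_and]
  rw [Finset.sum_eq_single i (fun a _ ha => by simp [ha.symm]) (by simp)]
  simp

lemma combine_fst_fst {L : Type*} [LieRing L] [LieAlgebra K L] (X : ℕ → L) {i j : Fin n}
    (h : i < j) : combine X (rootMat K (fst i) (fst j)) = chain X i (j - i - 1) := by
  have e (a b : Fin n) : rootMat K (fst i) (fst j) (fst a) (fst b) =
      if i = a ∧ j = b then 1 else 0 := by simp [rootMat_apply]
  simp only [combine_apply, e, sum_sum_ite_smul]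
  simp [rootMat_apply, h]

lemma combine_fst_mid {L : Type*} [LieRing L] [LieAlgebra K L] (X : ℕ → L) (i : Fin n) :
    combine X (rootMat K (fst i) mid) = chain X i (n - 1 - i) := by
  simp [combine_apply, rootMat_apply, ite_smul]

lemma combine_fst_lst {L : Type*} [LieRing L] [LieAlgebra K L] {X : ℕ → L} {N : ℕ}
    (R : Relations X N) (i j : Fin n) : combine X (rootMat K (fst i) (lst j)) =
      ⁅chain X i (n - 1 - i), chain X j (n - 1 - j)⁆ := by
  have e (a b : Fin n) : rootMat K (fst i) (lst j) (fst a) (lst b) =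
      (if i = a ∧ j = b then 1 else 0) + if j = a ∧ i = b then 1 else 0 := by simp [rootMat_apply]
  have e1 (a b : Fin n) : rootMat K (fst i) (lst j) (fst a) (fst b) = 0 := by simp [rootMat_apply]
  have e2 (a : Fin n) : rootMat K (fst i) (lst j) (fst a) mid = 0 := by simp [rootMat_apply]
  simp only [combine_apply, e, e1, e2, add_smul, Finset.sum_add_distrib, sum_sum_ite_smul,
    zero_smul, Finset.sum_const_zero, zero_add]
  -- The matrix has equal entries at `(i, j)` and `(j, i)`, and `combine` reads only the one above
  -- the diagonal; for `i = j` they cancel, as does the bracket.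
  rcases lt_trichotomy i j with h | rfl | h
  · rw [if_pos h, if_neg h.not_gt, add_zero]
  · simp
  · rw [if_pos h, if_neg h.not_gt, zero_add, R.lie_symm]

lemma map_chain {L L' : Type*} [LieRing L] [LieAlgebra K L] [LieRing L'] [LieAlgebra K L']
    (f : L →ₗ⁅K⁆ L') (X : ℕ → L) (i d : ℕ) : f (chain X i d) = chain (fun k => f (X k)) i d := by
  induction d generalizing i with
  | zero => rfl
  | succ d ih => rw [chain_succ, chain_succ, LieHom.map_lie, ih]

lemma chain_extend_eq_zero {L : Type*} [LieRing L] (a : Fin n → L) (i d : ℕ) (h : n ≤ i + d) :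
    chain (extend a) i d = 0 := by
  induction d generalizing i with
  | zero => exact extend_of_le a h
  | succ d ih => rw [chain_succ, ih _ (by omega), lie_zero]

variable (K n) in
/-- The projection of the free Lie algebra onto the presented Lie algebra. -/
def toPresented : FreeLieAlgebra K (Fin n) →ₗ⁅K⁆ Presented K n :=
  { (relIdeal K n).toSubmodule.mkQ with map_lie' := fun {_ _} => rfl }

lemma toPresented_of (i : Fin n) : toPresented K n (FreeLieAlgebra.of K i) = gen K n i := rfl

lemma toPresented_surjective : Function.Surjective (toPresented K n) :=
  Submodule.mkQ_surjective _

/-- By the universal property, the projection from the free algebra factors through the subalgebra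
generated by the generators. -/
lemma lieSpan_range_gen : LieSubalgebra.lieSpan K _ (Set.range (gen K n)) = ⊤ := by
  set S := LieSubalgebra.lieSpan K (Presented K n) (Set.range (gen K n))
  let f : FreeLieAlgebra K (Fin n) →ₗ⁅K⁆ S :=
    FreeLieAlgebra.lift K fun i => ⟨gen K n i, LieSubalgebra.subset_lieSpan ⟨i, rfl⟩⟩
  have hf : S.incl.comp f = toPresented K n := by
    ext i
    simp [f, toPresented_of]
  rw [eq_top_iff]
  intro z _
  obtain ⟨a, rfl⟩ := toPresented_surjective z
  rw [← hf]
  exact (f a).2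

/-! ### Comparison of the presented algebra with the matrices -/

variable [CharP K 2]

lemma chain_extend_x (i d : ℕ) (h : i + d < n) :
    chain (extend (x K n)) i d = rootMat K (pos n i) (pos n (i + d + 1)) := by
  induction d generalizing i with
  | zero => rw [chain_zero, extend_of_lt _ (by omega : i < n), x_eq, add_zero]
  | succ d ih =>
    rw [chain_succ, ih _ (by omega), extend_of_lt _ (by omega), x_eq, lie_rootMat]
    simp only [pos_eq_pos, pos_eq_bar_pos, show i + 1 + d + 1 = i + (d + 1) + 1 by omega]
    split_ifs <;> first | omega | simp

lemma relations_x : Relations (extend (x K n)) (n - 1) := by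
  have e1 (k : ℕ) (h : k < n) : extend (x K n) k = rootMat K (pos n k) (pos n (k + 1)) :=
    chain_extend_x k 0 h
  have e2 (k : ℕ) (h : k + 1 < n) : ⁅extend (x K n) k, extend (x K n) (k + 1)⁆ =
      rootMat K (pos n k) (pos n (k + 2)) := chain_extend_x k 1 h
  have e2' (k : ℕ) (h : k + 1 < n) : ⁅extend (x K n) (k + 1), extend (x K n) k⁆ =
      rootMat K (pos n k) (pos n (k + 2)) := by
    rw [← lie_skew, e2 k h]
    exact neg_eq_of_add_eq_zero_left (matrix_add_self _)
  have e0 (k : ℕ) (h : n ≤ k) : extend (x K n) k = 0 := extend_of_le _ h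
  refine ⟨matrix_add_self, fun k hk => e0 k (by omega), fun k j hkj => ?_, fun k hk => ?_,
    fun k hk => ?_, fun k hk => ?_, fun k => ?_⟩
  · rcases Nat.lt_or_ge j n with h | h
    · rw [e1 k (by omega), e1 j h, lie_rootMat]
      simp only [pos_eq_pos, pos_eq_bar_pos]
      split_ifs <;> first | omega | simp
    · rw [e0 j h, lie_zero]
  · rcases Nat.lt_or_ge (k + 1) n with h | h
    · rw [e2 k h, e1 k (by omega), lie_rootMat]
      simp only [pos_eq_pos, pos_eq_bar_pos]
      split_ifs <;> first | omega | simp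
    · rw [e0 _ h, lie_zero, lie_zero]
  · rcases Nat.lt_or_ge (k + 1) n with h | h
    · rw [e2' k h, e1 (k + 1) h, lie_rootMat]
      simp only [pos_eq_pos, pos_eq_bar_pos]
      split_ifs <;> first | omega | simp
    · rw [e0 _ h, zero_lie]
  · have h : k + 1 < n := by omega
    -- The double bracket is a nonzero root matrix, for the sum of the last two `e_i`; this is why
    -- the last Serre relation is cubic.
    have e : ⁅rootMat K (pos n (k + 1)) (pos n (k + 1 + 1)), rootMat K (pos n k) (pos n (k + 2))⁆ =
        rootMat K (pos n (k + 1)) (bar (pos n k)) := by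
      rw [lie_rootMat]
      simp only [pos_eq_pos, pos_eq_bar_pos]
      split_ifs <;> first | omega | simp
    rw [e2' k h, e1 (k + 1) h, e, lie_rootMat]
    simp only [pos_eq_pos, pos_eq_bar_pos, bar_bar]
    split_ifs <;> first | omega | simp
  · rcases Nat.lt_or_ge (k + 2) n with h | h
    · rw [e2 k (by omega), e2 (k + 1) (by omega), lie_rootMat]
      simp only [pos_eq_pos, pos_eq_bar_pos]
      split_ifs <;> first | omega | simp
    · rw [e0 _ h, lie_zero, lie_zero]

lemma lie_chain_extend_x (i j : ℕ) (hi : i < n) (hj : j < n) :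
    ⁅chain (extend (x K n)) i (n - 1 - i), chain (extend (x K n)) j (n - 1 - j)⁆ =
      rootMat K (fst ⟨i, hi⟩) (lst ⟨j, hj⟩) := by
  rw [chain_extend_x _ _ (by omega), chain_extend_x _ _ (by omega), pos_of_lt hi, pos_of_lt hj,
    pos_of_le (by omega), pos_of_le (by omega), ← rootMat_bar mid (fst ⟨j, hj⟩),
    bar_mid, lie_rootMat_mid _ _ (by simp) (by simp)]
  rfl

/-- The canonical homomorphism from the presented Lie algebra to matrices. -/
def presentedHom : Presented K n →ₗ⁅K⁆ Matrix (Idx n) (Idx n) K :=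
  have hker : (relIdeal K n).toSubmodule ≤
      LinearMap.ker (FreeLieAlgebra.lift K (x K n) : FreeLieAlgebra K (Fin n) →ₗ[K] _) := by
    have hR := (forall_relators_iff matrix_add_self (FreeLieAlgebra.lift K (x K n))).2
      (by simpa only [FreeLieAlgebra.lift_of_apply] using relations_x)
    have hle : relIdeal K n ≤ (FreeLieAlgebra.lift K (x K n)).ker :=
      LieSubmodule.lieSpan_le.2 fun r hr => LieHom.mem_ker.2 (hR r hr)
    exact fun r hr => LieHom.mem_ker.1 (hle hr)
  { (relIdeal K n).toSubmodule.liftQ _ hker with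
    map_lie' := by
      rintro ⟨a⟩ ⟨b⟩
      exact LieHom.map_lie (FreeLieAlgebra.lift K (x K n)) a b }

lemma presentedHom_gen (i : Fin n) : presentedHom (gen K n i) = x K n i :=
  FreeLieAlgebra.lift_of_apply (R := K) (x K n) i

lemma relations_gen : Relations (extend (gen K n)) (n - 1) := by
  have two (a : Presented K n) : a + a = 0 := by
    rw [← two_smul K a, CharTwo.two_eq_zero, zero_smul]
  exact (forall_relators_iff two (toPresented K n)).1 fun r hr =>
    (LieSubmodule.Quotient.mk_eq_zero' (N := relIdeal K n)).2 (LieSubmodule.subset_lieSpan hr)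

/-- `combine` is a linear left inverse; this needs checking only on the spanning set of chains and
brackets of maximal chains. -/
lemma presentedHom_injective : Function.Injective (presentedHom (K := K) (n := n)) := by
  have R := relations_gen (K := K) (n := n)
  have hX : (fun k => presentedHom (extend (gen K n) k)) = extend (x K n) := by
    funext k
    unfold extend
    split_ifs
    · exact presentedHom_gen _
    · exact map_zero _
  have hchain (i d : ℕ) : presentedHom (chain (extend (gen K n)) i d) =
      chain (extend (x K n)) i d := by rw [map_chain, hX]
  have key : combine (n := n) (extend (gen K n)) ∘ₗ
      (presentedHom (K := K) (n := n) : Presented K n →ₗ[K] _) = LinearMap.id := by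
    refine LinearMap.ext_on (R.chainSpan_eq_top
      (lieSpan_range_extend (K := K) _ lieSpan_range_gen)) ?_
    rintro _ (⟨i, d, rfl⟩ | ⟨i, j, hi, hj, rfl⟩)
    · change combine _ (presentedHom _) = _
      rw [hchain, LinearMap.id_apply]
      rcases Nat.lt_or_ge (i + d) n with h | h
      · rw [chain_extend_x _ _ h, pos_of_lt (by omega)]
        rcases Nat.lt_or_ge (i + d + 1) n with h' | h'
        · rw [pos_of_lt h', combine_fst_fst _ (by simp [Fin.lt_def])]
          congr 1
          simp only
          omega
        · rw [pos_of_le h', combine_fst_mid]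
          congr 1
          simp only
          omega
      · rw [chain_extend_eq_zero _ _ _ h, chain_extend_eq_zero _ _ _ h, map_zero]
    · change combine _ (presentedHom _) = _
      rw [LieHom.map_lie, hchain, hchain, LinearMap.id_apply]
      -- For `n = 0` truncated subtraction makes `n - 1 = 0`, so `i ≤ n - 1` does not make `i` an
      -- index.
      rcases Nat.eq_zero_or_pos n with rfl | hn
      · rw [chain_extend_eq_zero _ _ _ (Nat.zero_le _), chain_extend_eq_zero _ i _ (Nat.zero_le _),
          zero_lie, zero_lie, map_zero]
      · rw [lie_chain_extend_x _ _ (by omega) (by omega), combine_fst_lst R]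
  exact Function.LeftInverse.injective (g := combine (extend (gen K n)))
    fun a => LinearMap.congr_fun key a

lemma range_presentedHom : (presentedHom (K := K) (n := n)).range = nPlus K n := by
  rw [LieHom.range_eq_map, ← lieSpan_range_gen, LieSubalgebra.map_lieSpan, nPlus, ← Set.range_comp]
  congr 2
  exact funext presentedHom_gen

/-- The presented Lie algebra is isomorphic to the Lie algebra generated by the `x_i`. -/
def presentedEquiv : Presented K n ≃ₗ⁅K⁆ nPlus K n :=
  (LieEquiv.ofInjective presentedHom presentedHom_injective).trans
    (LieEquiv.ofEq _ _ (congrArg _ range_presentedHom))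

lemma coe_presentedEquiv (a : Presented K n) :
    (presentedEquiv a : Matrix (Idx n) (Idx n) K) = presentedHom a := rfl

end Presentation

end OrthPi

end

theorem theorem8p5 (K : Type*) [Field K] [CharP K 2] (n : ℕ) (hn : 1 ≤ n) :
    -- the `x_i`, `y_i` generate the derived algebra, as Chevalley generators for the Cartan matrix
    LieSubalgebra.lieSpan K _ (Set.range (OrthPi.x K n) ∪ Set.range (OrthPi.y K n))
        = OrthPi.orthDerived K n ∧
    (∀ i j : Fin n,
      ⁅OrthPi.x K n i, OrthPi.y K n j⁆ = (if i = j then OrthPi.h K n i else 0) ∧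
      ⁅OrthPi.h K n i, OrthPi.h K n j⁆ = 0 ∧
      ⁅OrthPi.h K n i, OrthPi.x K n j⁆ = OrthPi.cartan K n i j • OrthPi.x K n j ∧
      ⁅OrthPi.h K n i, OrthPi.y K n j⁆ = -(OrthPi.cartan K n i j • OrthPi.y K n j)) ∧
    -- the relations define the Lie algebra generated by the `x_i`
    ∃ e : OrthPi.Presented K n ≃ₗ⁅K⁆ OrthPi.nPlus K n,
      ∀ i : Fin n,
        ((e (OrthPi.gen K n i) : OrthPi.nPlus K n) :
          Matrix (OrthPi.Idx n) (OrthPi.Idx n) K) = OrthPi.x K n i := by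
  refine ⟨OrthPi.lieSpan_eq_orthDerived, fun i j => ⟨OrthPi.lie_x_y i j, OrthPi.lie_h_h i j,
    OrthPi.lie_h_x i j, OrthPi.lie_h_y i j⟩, OrthPi.presentedEquiv, fun i => ?_⟩
  rw [OrthPi.coe_presentedEquiv, OrthPi.presentedHom_gen]
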